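/- There is an absolute constant $C$ such that the following holds. Let $M = U\Sigma V^T \in \mathbb{R}^{n_1\times n_2}$ be a (compact) singular value decomposition of a matrix of rank $r \ge 1$ (so $U \in \mathbb{R}^{n_1\times r}$ and $V \in \mathbb{R}^{n_2 \times r}$ have orthonormal columns), let $c_1,\dots,c_{n_2}$ be the columns of $M$, and assume that the coherence of the column space satisfies $$\mu(U) := \frac{n_1}{r}\max_{1\le j\le n_1}\|\mathcal{P}_U e_j\|^2 \le \mu_0 ;$$ nothing is assumed about the row space. Fix $\delta > 0$ and an integer $m \ge 36\, r^{3/2}\mu_0 \log(2r/\delta)$, $m \ge 0$. Consider the following sequential algorithm, which can observe entries of $M$ one at a time. It draws $m$ row indices independently and uniformly, with replacement, from $\{1,\dots,n_1\}$; let $\Omega$ be the set of indices drawn. It starts with the empty orthonormal basis $\tilde U = \emptyset$. For $i = 1,\dots,n_2$ it observes the entries $c_{i\Omega}$ of the $i$-th column in the rows of $\Omega$. If $\|c_{i\Omega} - \mathcal{P}_{\tilde U_\Omega} c_{i\Omega}\|^2 > 0$, where $\tilde U_\Omega$ consists of the rows of $\tilde U$ indexed by $\Omega$, it observes $c_i$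 in full, puts $\hat c_i = c_i$, and appends $\mathcal{P}_{\tilde U^\perp} c_i/\|\mathcal{P}_{\tilde U^\perp} c_i\|$ to $\tilde U$. Otherwise it puts $\hat c_i = \tilde U(\tilde U_\Omega^T\tilde U_\Omega)^{-1}\tilde U_\Omega^T c_{i\Omega}$. It returns the matrix $\hat M$ with columns $\hat c_1,\dots,\hat c_{n_2}$. Then: 1. $\hat M = M$ with probability at least $1 - 4r\delta + \delta$. 2. The expected number of observed entries is at most $n_2 m + r n_1$; in particular, if $m = 36\, r^{3/2}\mu_0\log(2r/\delta)$, it is at most $$36\, n_2\, r^{3/2}\mu_0\log(2r/\delta) + r n_1 .$$ 3. The algorithm, implemented on a real random access machine on which every arithmetic operation, square root, comparison, loop iteration, random draw and observation of an entry costs one step, runs in $O(n_1 n_2 r + r^3 m)$ time: for every outcome of the draws it takes at most $C\,(n_1 n_2 r + r^3 m)$ steps. -/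

import Mathlib

open Matrix MeasureTheory ProbabilityTheory

/-! ### Coherence -/

/-- The span in `ℝⁿ` (with the Euclidean norm) of the columns of an `n × d` matrix. -/
def columnSpan {n d : ℕ} (U : Matrix (Fin n) (Fin d) ℝ) :
    Submodule ℝ (EuclideanSpace ℝ (Fin n)) :=
  Submodule.span ℝ (Set.range fun a : Fin d => WithLp.toLp 2 (fun i => U i a))

/-- The coherence `μ(W) = (n / dim W) max_j ‖P_W e_j‖²` of a subspace `W` of `ℝⁿ`. -/
noncomputable def coherence {n : ℕ} (W : Submodule ℝ (EuclideanSpace ℝ (Fin n))) : ℝ :=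
  ((n : ℝ) / (Module.finrank ℝ W : ℝ)) *
    ⨆ j : Fin n, ‖W.starProjection (EuclideanSpace.single j (1 : ℝ))‖ ^ 2

/-! ### Programs of a real random access machine

A program has access to the entries of an unknown `n₁ × n₂` matrix (one entry per query) and to `m`
independent uniform draws from the row indices. Programs are written for an arbitrary type `R` of
scalars, so the only thing a program can do with a scalar is to pass it to one of the instructions
below. Every instruction costs one step. Reading and writing an array cell (arrays are functions on
`Fin k`) is part of the instruction or of the loop iteration in which it occurs; each iteration of a
loop is charged one step of its own. -/

/-- The arithmetic instructions with two operands. -/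
inductive ArithOp : Type
  | add | sub | mul | div

/-- Programs that return a value of type `α`. -/
inductive Prog (n₁ n₂ m : ℕ) (R α : Type) : Type
  /-- stop and return `a` -/
  | ret (a : α)
  /-- a step of loop control or index bookkeeping -/
  | tick (k : Prog n₁ n₂ m R α)
  /-- load the constant `0` -/
  | zero (k : R → Prog n₁ n₂ m R α)
  /-- load the constant `1` -/
  | one (k : R → Prog n₁ n₂ m R α)
  /-- an arithmetic operation -/
  | arith (o : ArithOp) (x y : R) (k : R → Prog n₁ n₂ m R α)
  /-- a square root -/
  | sqrt (x : R) (k : R → Prog n₁ n₂ m R α)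
  /-- branch on whether `x` is positive -/
  | isPos (x : R) (k : Bool → Prog n₁ n₂ m R α)
  /-- obtain the `t`-th random row index -/
  | draw (t : Fin m) (k : Fin n₁ → Prog n₁ n₂ m R α)
  /-- observe the entry in row `i` and column `j` of the unknown matrix -/
  | observe (i : Fin n₁) (j : Fin n₂) (k : R → Prog n₁ n₂ m R α)

namespace Prog

variable {n₁ n₂ m : ℕ} {R α β σ : Type}

/-- Sequential composition. -/
def bind : Prog n₁ n₂ m R α → (α → Prog n₁ n₂ m R β) → Prog n₁ n₂ m R β
  | ret a, f => f a
  | tick k, f => tick (bind k f)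
  | zero k, f => zero fun x => bind (k x) f
  | one k, f => one fun x => bind (k x) f
  | arith o x y k, f => arith o x y fun z => bind (k z) f
  | sqrt x k, f => sqrt x fun z => bind (k z) f
  | isPos x k, f => isPos x fun b => bind (k b) f
  | draw t k, f => draw t fun i => bind (k i) f
  | observe i j k, f => observe i j fun x => bind (k x) f

instance : Monad (Prog n₁ n₂ m R) where
  pure := ret
  bind := bind

/-! #### Execution over the real numbers, on the matrix `M` and the draws `ω` -/

/-- The value of an arithmetic instruction. -/
noncomputable def arithVal : ArithOp → ℝ → ℝ → ℝ
  | .add, x, y => x + y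
  | .sub, x, y => x - y
  | .mul, x, y => x * y
  | .div, x, y => x / y

/-- The value returned by a program. -/
noncomputable def eval (M : Matrix (Fin n₁) (Fin n₂) ℝ) (ω : Fin m → Fin n₁) :
    Prog n₁ n₂ m ℝ α → α
  | ret a => a
  | tick k => eval M ω k
  | zero k => eval M ω (k 0)
  | one k => eval M ω (k 1)
  | arith o x y k => eval M ω (k (arithVal o x y))
  | sqrt x k => eval M ω (k (Real.sqrt x))
  | isPos x k => eval M ω (k (decide (0 < x)))
  | draw t k => eval M ω (k (ω t))
  | observe i j k => eval M ω (k (M i j))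

/-- The running time: the number of instructions that are executed. -/
noncomputable def steps (M : Matrix (Fin n₁) (Fin n₂) ℝ) (ω : Fin m → Fin n₁) :
    Prog n₁ n₂ m ℝ α → ℕ
  | ret _ => 0
  | tick k => steps M ω k + 1
  | zero k => steps M ω (k 0) + 1
  | one k => steps M ω (k 1) + 1
  | arith o x y k => steps M ω (k (arithVal o x y)) + 1
  | sqrt x k => steps M ω (k (Real.sqrt x)) + 1
  | isPos x k => steps M ω (k (decide (0 < x))) + 1
  | draw t k => steps M ω (k (ω t)) + 1
  | observe i j k => steps M ω (k (M i j)) + 1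

/-- The number of observations of matrix entries that are made (repetitions count). -/
noncomputable def observations (M : Matrix (Fin n₁) (Fin n₂) ℝ) (ω : Fin m → Fin n₁) :
    Prog n₁ n₂ m ℝ α → ℕ
  | ret _ => 0
  | tick k => observations M ω k
  | zero k => observations M ω (k 0)
  | one k => observations M ω (k 1)
  | arith o x y k => observations M ω (k (arithVal o x y))
  | sqrt x k => observations M ω (k (Real.sqrt x))
  | isPos x k => observations M ω (k (decide (0 < x)))
  | draw t k => observations M ω (k (ω t))
  | observe i j k => observations M ω (k (M i j)) + 1

/-! #### Loops -/

/-- `for i = 0, …, k - 1: s ← body i s`; returns the final state. -/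
def loop : (k : ℕ) → (Fin k → σ → Prog n₁ n₂ m R σ) → σ → Prog n₁ n₂ m R σ
  | 0, _, s => ret s
  | k + 1, body, s => tick (bind (body 0 s) fun s' => loop k (fun i => body i.succ) s')

/-- `for i = 0, …, k - 1: (v i, s) ← body i s`; returns the array `v` and the final state. -/
def mapLoop : (k : ℕ) → (Fin k → σ → Prog n₁ n₂ m R (α × σ)) → σ →
    Prog n₁ n₂ m R ((Fin k → α) × σ)
  | 0, _, s => ret (Fin.elim0, s)
  | k + 1, body, s => tick (bind (body 0 s) fun p =>
      bind (mapLoop k (fun i => body i.succ) p.2) fun q => ret (Fin.cons p.1 q.1, q.2))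

/-- `for i = 0, …, k - 1: v i ← body i`; returns the array `v`. -/
def table : (k : ℕ) → (Fin k → Prog n₁ n₂ m R α) → Prog n₁ n₂ m R (Fin k → α)
  | 0, _ => ret Fin.elim0
  | k + 1, body => tick (bind (body 0) fun a =>
      bind (table k fun i => body i.succ) fun v => ret (Fin.cons a v))

/-! #### Linear algebra subroutines -/

/-- The inner product of two vectors. -/
def dot {k : ℕ} (x y : Fin k → R) : Prog n₁ n₂ m R R := do
  let z ← zero ret
  loop k (fun i s => do
    let p ← arith .mul (x i) (y i) ret
    arith .add s p ret) z

/-- The product of a matrix and a vector. -/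
def mulVec {k l : ℕ} (A : Fin k → Fin l → R) (x : Fin l → R) : Prog n₁ n₂ m R (Fin k → R) :=
  table k fun a => dot (A a) x

/-- The vector `x - y`. -/
def vecSub {k : ℕ} (x y : Fin k → R) : Prog n₁ n₂ m R (Fin k → R) :=
  table k fun i => arith .sub (x i) (y i) ret

/-- Inversion of a symmetric positive definite matrix by bordering: if `H` inverts the leading
block `A` of `G = [A, b; bᵀ, d]`, then with `v = H b` and `s = d - bᵀ v` the inverse of `G` is
`[H, 0; 0, 0] + s⁻¹ (v, -1) (v, -1)ᵀ`. -/
def invert : (k : ℕ) → (Fin k → Fin k → R) → Prog n₁ n₂ m R (Fin k → Fin k → R)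
  | 0, _ => ret Fin.elim0
  | k + 1, G => do
    let H ← invert k fun a b => G a.castSucc b.castSucc
    let b : Fin k → R := fun a => G a.castSucc (Fin.last k)
    let v ← mulVec H b
    let q ← dot b v
    let s ← arith .sub (G (Fin.last k) (Fin.last k)) q ret
    let z ← zero ret
    let e ← one ret
    let e' ← arith .sub z e ret
    let w : Fin (k + 1) → R := Fin.snoc (α := fun _ => R) v e'
    let H₀ : Fin (k + 1) → Fin (k + 1) → R :=
      Fin.snoc (α := fun _ => Fin (k + 1) → R) (fun a => Fin.snoc (α := fun _ => R) (H a) z)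
        (fun _ => z)
    table (k + 1) fun a => table (k + 1) fun c => do
      let p ← arith .mul (w a) (w c) ret
      let p' ← arith .div p s ret
      arith .add (H₀ a c) p' ret

/-! #### The sequential completion algorithm -/

/-- Make the `m` uniform draws (with replacement) from the row indices and list, in increasing order
and without repetition, the set `Ω` of the indices that occur. The list is used as an array: an
index is pushed at its end, and cells are read by position afterwards. -/
def sampleRows : Prog n₁ n₂ m R (List (Fin n₁)) := do
  let none ← table n₁ fun _ => ret false
  let mark ← loop m (fun t mark => do
    let i ← draw t ret
    ret (Function.update mark i true)) none
  loop n₁ (fun i l => ret (if mark i then l ++ [i] else l)) []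

/-- The candidate column space: its dimension `d`, an orthonormal basis `U 0, …, U (d - 1)`, and the
inverse `H` of the Gram matrix `U_Ωᵀ U_Ω` of the basis vectors restricted to the sampled rows. -/
structure Candidate (n₁ : ℕ) (R : Type) : Type where
  /-- the dimension -/
  d : ℕ
  /-- the basis -/
  U : Fin d → Fin n₁ → R
  /-- the inverse of the Gram matrix of the restricted basis -/
  H : Fin d → Fin d → R

/-- The candidate `{0}`, with the empty basis. -/
def Candidate.empty : Candidate n₁ R := ⟨0, Fin.elim0, Fin.elim0⟩

/-- Add to the candidate space the column `x`, which is known in full: append to the basis the vector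
`P_{U^⊥} x / ‖P_{U^⊥} x‖`, and recompute `(U_Ωᵀ U_Ω)⁻¹`. -/
def extend {s : ℕ} (Ω : Fin s → Fin n₁) (c : Candidate n₁ R) (x : Fin n₁ → R) :
    Prog n₁ n₂ m R (Candidate n₁ R) := do
  let b ← mulVec c.U x
  let p ← mulVec (fun i a => c.U a i) b
  let w ← vecSub x p
  let e ← dot w w
  let nrm ← sqrt e ret
  let u ← table n₁ fun i => arith .div (w i) nrm ret
  let U' : Fin (c.d + 1) → Fin n₁ → R := Fin.snoc (α := fun _ => Fin n₁ → R) c.U u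
  let G ← table (c.d + 1) fun a => table (c.d + 1) fun a' =>
    dot (fun t => U' a (Ω t)) (fun t => U' a' (Ω t))
  let H ← invert (c.d + 1) G
  ret ⟨c.d + 1, U', H⟩

/-- The treatment of column `j`. Observe `y = c_Ω`, put `α = (U_Ωᵀ U_Ω)⁻¹ U_Ωᵀ y`, and compute
`‖y - U_Ω α‖² = ‖y - P_{U_Ω} y‖²`. If this is positive, observe the column in full and add it to the
candidate space; otherwise estimate the column by `U α`. -/
def column {s : ℕ} (Ω : Fin s → Fin n₁) (j : Fin n₂) (c : Candidate n₁ R) :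
    Prog n₁ n₂ m R ((Fin n₁ → R) × Candidate n₁ R) := do
  let y ← table s fun t => observe (Ω t) j ret
  let b ← mulVec (fun a t => c.U a (Ω t)) y
  let α ← mulVec c.H b
  let p ← mulVec (fun t a => c.U a (Ω t)) α
  let res ← vecSub y p
  let e ← dot res res
  let new ← isPos e ret
  if new then
    let x ← table n₁ fun i => observe i j ret
    let c' ← extend Ω c x
    ret (x, c')
  else
    let x ← mulVec (fun i a => c.U a i) α
    ret (x, c)

/-- The sequential algorithm: draw `Ω` once, then pass through the columns in order. The output is
the completed matrix. -/
def sequentialCompletion (n₁ n₂ m : ℕ) (R : Type) :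
    Prog n₁ n₂ m R (Matrix (Fin n₁) (Fin n₂) R) := do
  let l ← sampleRows
  let out ← mapLoop n₂ (fun j c => column l.get j c) Candidate.empty
  ret (Matrix.of fun i j => out.1 j i)

end Prog

/-! The argument separates a deterministic statement from a probabilistic one. Let `W` be the column
space of `M`.

Deterministic part (`column_spec`, `sequentialCompletion_spec`). The candidate basis stays inside
`W`, and its restriction to `Ω` stays linearly independent. The Gram matrix is therefore positive
definite, and bordering inverts it. A positive residual means that the sampled column lies outside
the restricted span, so extending preserves the invariant and raises the dimension; this happens at
most `r` times. With zero residual, the estimate and the true column are two vectors of `W` that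
agree on `Ω`. So recovery is exact whenever no nonzero vector of `W` vanishes on `Ω`. Using the
dimension as a potential charges full observations and Gram recomputations to the extensions, for
every outcome of the draws.

Probabilistic part (`sum_finrank_vanishingOn_le`). Let `K` be the space of vectors of `W` vanishing
at the rows drawn so far, and let `B = rμ₀/n₁` bound `‖P_W e_i‖²`. Drawing row `i` lowers `dim K` by
at least `‖P_K e_i‖² / B`. Since `∑ ‖P_K e_i‖² = dim K`, each draw multiplies the expected dimension
by at most `1 - 1/(rμ₀)`. Markov's inequality bounds the failure probability by `r exp(-m/(rμ₀)) ≤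
δ/2`. No matrix concentration is needed. -/

namespace Prog

/-! ### Values, running times and observation counts of programs -/

section Semantics

variable {n₁ n₂ m : ℕ} {α β σ : Type} (M : Matrix (Fin n₁) (Fin n₂) ℝ) (ω : Fin m → Fin n₁)

@[simp] theorem eval_bind (p : Prog n₁ n₂ m ℝ α) (f : α → Prog n₁ n₂ m ℝ β) :
    (p >>= f).eval M ω = (f (p.eval M ω)).eval M ω := by
  change (bind p f).eval M ω = _
  induction p with
  | isPos x k ih => exact ih _
  | _ => simp_all [bind, eval]

@[simp] theorem steps_bind (p : Prog n₁ n₂ m ℝ α) (f : α → Prog n₁ n₂ m ℝ β) :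
    (p >>= f).steps M ω = p.steps M ω + (f (p.eval M ω)).steps M ω := by
  change (bind p f).steps M ω = _
  induction p with
  | ret => simp [bind, eval, steps]
  | isPos x k ih => simp only [bind, eval, steps, ih]; omega
  | _ => simp_all [bind, eval, steps]; omega

@[simp] theorem observations_bind (p : Prog n₁ n₂ m ℝ α) (f : α → Prog n₁ n₂ m ℝ β) :
    (p >>= f).observations M ω =
      p.observations M ω + (f (p.eval M ω)).observations M ω := by
  change (bind p f).observations M ω = _
  induction p with
  | ret => simp [bind, eval, observations]
  | isPos x k ih => simp only [bind, eval, observations, ih]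
  | _ => simp_all [bind, eval, observations] <;> omega

theorem bind_eq (p : Prog n₁ n₂ m ℝ α) (f : α → Prog n₁ n₂ m ℝ β) : bind p f = p >>= f := rfl

theorem steps_loop {k c : ℕ} {body : Fin k → σ → Prog n₁ n₂ m ℝ σ}
    (h : ∀ i s, (body i s).steps M ω = c) (s : σ) :
    (loop k body s).steps M ω = k * (c + 1) := by
  induction k generalizing s with
  | zero => simp [loop, steps]
  | succ k ih =>
    simp only [loop, steps, bind_eq, steps_bind, h]
    rw [ih fun i => h i.succ]
    ring

theorem observations_loop {k : ℕ} {body : Fin k → σ → Prog n₁ n₂ m ℝ σ}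
    (h : ∀ i s, (body i s).observations M ω = 0) (s : σ) :
    (loop k body s).observations M ω = 0 := by
  induction k generalizing s with
  | zero => simp [loop, observations]
  | succ k ih =>
    simp only [loop, observations, bind_eq, observations_bind, h]
    rw [ih fun i => h i.succ]

theorem eval_table {k : ℕ} (body : Fin k → Prog n₁ n₂ m ℝ α) :
    (table k body).eval M ω = fun i => (body i).eval M ω := by
  induction k with
  | zero => exact funext fun i => i.elim0
  | succ k ih =>
    simp only [table, eval, bind_eq, eval_bind, ih]
    funext i
    refine Fin.cases ?_ (fun i => ?_) i <;> simp

theorem steps_table {k c : ℕ} {body : Fin k → Prog n₁ n₂ m ℝ α}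
    (h : ∀ i, (body i).steps M ω = c) : (table k body).steps M ω = k * (c + 1) := by
  induction k with
  | zero => simp [table, steps]
  | succ k ih =>
    simp only [table, steps, bind_eq, steps_bind, h]
    rw [ih fun i => h i.succ]
    ring

theorem observations_table {k c : ℕ} {body : Fin k → Prog n₁ n₂ m ℝ α}
    (h : ∀ i, (body i).observations M ω = c) : (table k body).observations M ω = k * c := by
  induction k with
  | zero => simp [table, observations]
  | succ k ih =>
    simp only [table, observations, bind_eq, observations_bind, h]
    rw [ih fun i => h i.succ]
    ring

/-- A loop whose body preserves an invariant `I`, with amortized bounds on the running time and the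
number of observations in terms of a potential `φ`. -/
theorem mapLoop_spec {k a b a' b' : ℕ} {body : Fin k → σ → Prog n₁ n₂ m ℝ (α × σ)}
    {I : σ → Prop} {Q : Fin k → α → Prop} {φ : σ → ℕ}
    (hI : ∀ j s, I s → I ((body j s).eval M ω).2)
    (hQ : ∀ j s, I s → Q j ((body j s).eval M ω).1)
    (hsteps : ∀ j s, I s →
      (body j s).steps M ω + b * φ s ≤ a + b * φ ((body j s).eval M ω).2)
    (hobs : ∀ j s, I s →
      (body j s).observations M ω + b' * φ s ≤ a' + b' * φ ((body j s).eval M ω).2)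
    (s : σ) (hs : I s) :
    I ((mapLoop k body s).eval M ω).2 ∧ (∀ j, Q j (((mapLoop k body s).eval M ω).1 j)) ∧
      (mapLoop k body s).steps M ω + b * φ s ≤
        k * (a + 1) + b * φ ((mapLoop k body s).eval M ω).2 ∧
      (mapLoop k body s).observations M ω + b' * φ s ≤
        k * a' + b' * φ ((mapLoop k body s).eval M ω).2 := by
  induction k generalizing s with
  | zero => exact ⟨hs, fun j => j.elim0, by simp [mapLoop, steps, eval],
      by simp [mapLoop, observations, eval]⟩
  | succ k ih =>
    obtain ⟨h1, h2, h3, h4⟩ := ih (body := fun i => body i.succ) (Q := fun i => Q i.succ)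
      (fun j => hI j.succ) (fun j => hQ j.succ) (fun j => hsteps j.succ) (fun j => hobs j.succ)
      _ (hI 0 s hs)
    have h5 := hsteps 0 s hs
    have h6 := hobs 0 s hs
    simp only [mapLoop, eval, steps, observations, bind_eq, eval_bind, steps_bind,
      observations_bind]
    refine ⟨h1, fun j => ?_, ?_, ?_⟩
    · refine Fin.cases ?_ (fun j => ?_) j
      · simpa using hQ 0 s hs
      · simpa using h2 j
    · linarith
    · linarith

/-! ### Linear algebra subroutines -/

theorem dot_spec {k : ℕ} (x y : Fin k → ℝ) :
    (dot x y : Prog n₁ n₂ m ℝ ℝ).eval M ω = x ⬝ᵥ y ∧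
    (dot x y : Prog n₁ n₂ m ℝ ℝ).steps M ω = 3 * k + 1 ∧
    (dot x y : Prog n₁ n₂ m ℝ ℝ).observations M ω = 0 := by
  refine ⟨?_, ?_, ?_⟩
  · simp only [dot, eval_bind, eval]
    -- The accumulator must be arbitrary for the induction.
    suffices ∀ z, (loop k (fun i s => do
        let p ← arith .mul (x i) (y i) ret
        arith .add s p ret) z : Prog n₁ n₂ m ℝ ℝ).eval M ω = z + x ⬝ᵥ y by simp [this]
    induction k with
    | zero => simp [loop, eval]
    | succ k ih =>
      intro z
      simp only [loop, eval, bind_eq, eval_bind]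
      rw [ih (fun i => x i.succ) (fun i => y i.succ)]
      simp [arithVal, dotProduct, Fin.sum_univ_succ, add_assoc]
  · simp only [dot, steps_bind, steps, eval]
    rw [steps_loop (c := 2)]
    · ring
    · intro i s; simp [steps]
  · simp only [dot, observations_bind, observations, eval]
    rw [observations_loop]
    intro i s; simp [observations]

@[simp] theorem eval_dot {k : ℕ} (x y : Fin k → ℝ) :
    (dot x y : Prog n₁ n₂ m ℝ ℝ).eval M ω = x ⬝ᵥ y := (dot_spec M ω x y).1

@[simp] theorem steps_dot {k : ℕ} (x y : Fin k → ℝ) :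
    (dot x y : Prog n₁ n₂ m ℝ ℝ).steps M ω = 3 * k + 1 := (dot_spec M ω x y).2.1

@[simp] theorem observations_dot {k : ℕ} (x y : Fin k → ℝ) :
    (dot x y : Prog n₁ n₂ m ℝ ℝ).observations M ω = 0 := (dot_spec M ω x y).2.2

@[simp] theorem eval_mulVec {k l : ℕ} (A : Fin k → Fin l → ℝ) (x : Fin l → ℝ) :
    (mulVec A x : Prog n₁ n₂ m ℝ (Fin k → ℝ)).eval M ω = Matrix.mulVec A x := by
  simp only [mulVec, eval_table, eval_dot]
  rfl

@[simp] theorem steps_mulVec {k l : ℕ} (A : Fin k → Fin l → ℝ) (x : Fin l → ℝ) :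
    (mulVec A x : Prog n₁ n₂ m ℝ (Fin k → ℝ)).steps M ω = k * (3 * l + 2) :=
  steps_table M ω fun _ => steps_dot M ω _ _

@[simp] theorem observations_mulVec {k l : ℕ} (A : Fin k → Fin l → ℝ) (x : Fin l → ℝ) :
    (mulVec A x : Prog n₁ n₂ m ℝ (Fin k → ℝ)).observations M ω = 0 :=
  observations_table M ω fun _ => observations_dot M ω _ _

@[simp] theorem eval_vecSub {k : ℕ} (x y : Fin k → ℝ) :
    (vecSub x y : Prog n₁ n₂ m ℝ (Fin k → ℝ)).eval M ω = x - y := by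
  simp only [vecSub, eval_table, eval, arithVal]
  rfl

@[simp] theorem steps_vecSub {k : ℕ} (x y : Fin k → ℝ) :
    (vecSub x y : Prog n₁ n₂ m ℝ (Fin k → ℝ)).steps M ω = k * 2 :=
  steps_table M ω fun _ => by simp [steps]

@[simp] theorem observations_vecSub {k : ℕ} (x y : Fin k → ℝ) :
    (vecSub x y : Prog n₁ n₂ m ℝ (Fin k → ℝ)).observations M ω = 0 :=
  observations_table M ω (c := 0) fun _ => by simp [observations]

/-- Inversion of a positive definite matrix by bordering. -/
theorem bordering {k : ℕ} {G : Matrix (Fin (k + 1)) (Fin (k + 1)) ℝ} (hG : G.PosDef)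
    {H : Matrix (Fin k) (Fin k) ℝ} (hH : G.submatrix Fin.castSucc Fin.castSucc * H = 1)
    {b v : Fin k → ℝ} {s : ℝ} {w : Fin (k + 1) → ℝ} {H₀ : Fin (k + 1) → Fin (k + 1) → ℝ}
    (hb : b = fun a => G a.castSucc (Fin.last k)) (hv : v = H *ᵥ b)
    (hs : s = G (Fin.last k) (Fin.last k) - b ⬝ᵥ v)
    (hw : w = Fin.snoc (α := fun _ => ℝ) v (-1))
    (hH₀ : H₀ = Fin.snoc (α := fun _ => Fin (k + 1) → ℝ)
      (fun a => Fin.snoc (α := fun _ => ℝ) (H a) 0) (fun _ => 0)) :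
    G * Matrix.of (fun a c => H₀ a c + w a * w c / s) = 1 := by
  set A := G.submatrix (Fin.castSucc : Fin k → _) Fin.castSucc with hA
  have hsym : ∀ i j, G i j = G j i := fun i j => by
    simpa using congrFun (congrFun hG.isHermitian j) i
  have hAsym : Aᵀ = A := by ext i j; exact hsym _ _
  have hHA : H * A = 1 := mul_eq_one_comm.mp hH
  have hHsym : Hᵀ = H := by
    calc Hᵀ = Hᵀ * (A * H) := by rw [hH, Matrix.mul_one]
      _ = (A * H)ᵀ * H := by rw [Matrix.transpose_mul, hAsym, ← Matrix.mul_assoc]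
      _ = H := by rw [hH]; simp
  have hAv : A *ᵥ v = b := by rw [hv, Matrix.mulVec_mulVec, hH, Matrix.one_mulVec]
  have hbH : b ᵥ* H = v := by rw [hv, ← Matrix.vecMul_transpose, hHsym]
  have hAv' : ∀ a, ∑ x, A a x * v x = b a := fun a => congrFun hAv a
  have hbH' : ∀ c, ∑ x, b x * H x c = v c := fun c => congrFun hbH c
  have hAH' : ∀ a c, ∑ x, A a x * H x c = (1 : Matrix (Fin k) (Fin k) ℝ) a c := fun a c => by
    rw [← hH]; rfl
  have hGb : ∀ a : Fin k, G a.castSucc (Fin.last k) = b a := fun a => by rw [hb]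
  have hGb' : ∀ a : Fin k, G (Fin.last k) a.castSucc = b a := fun a => by rw [hsym, hGb]
  have hGA : ∀ a c : Fin k, G a.castSucc c.castSucc = A a c := fun a c => rfl
  have hs' : G (Fin.last k) (Fin.last k) = s + ∑ x, b x * v x := by
    rw [hs, dotProduct]; ring
  -- `w = (v, -1)` with `A v = b`, so `G` sends it to a multiple of the last basis vector; `s` is
  -- the Schur complement.
  have hGw : G *ᵥ w = Fin.snoc (α := fun _ => ℝ) (0 : Fin k → ℝ) (-s) := by
    ext i
    refine Fin.lastCases ?_ (fun a => ?_) i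
    · simp [Matrix.mulVec, dotProduct, Fin.sum_univ_castSucc, hw, hGb', hs']
    · simp [Matrix.mulVec, dotProduct, Fin.sum_univ_castSucc, hw, hGb, hGA, hAv']
  have hw0 : w ≠ 0 := fun h => by
    have := congrFun h (Fin.last k)
    simp [hw] at this
  -- `wᵀ G w = s`, so positive definiteness makes the division by `s` legitimate.
  have hspos : 0 < s := by
    have := hG.dotProduct_mulVec_pos hw0
    rw [hGw] at this
    simpa [dotProduct, Fin.sum_univ_castSucc, hw] using this
  ext i j
  simp only [Matrix.mul_apply, Matrix.of_apply]
  refine Fin.lastCases ?_ (fun a => ?_) i <;> refine Fin.lastCases ?_ (fun c => ?_) j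
  · simp only [Fin.sum_univ_castSucc, hH₀, hw, hGb', hs', Fin.snoc_last, Fin.snoc_castSucc,
      Matrix.one_apply_eq]
    have : ∀ x, b x * (0 + v x * -1 / s) = -(b x * v x) / s := fun x => by ring
    simp only [this, ← Finset.sum_div, Finset.sum_neg_distrib]
    field_simp
    ring
  · simp only [Fin.sum_univ_castSucc, hH₀, hw, hGb', hs', Fin.snoc_last, Fin.snoc_castSucc]
    have : ∀ x, b x * (H x c + v x * v c / s) = b x * H x c + b x * v x * (v c / s) :=
      fun x => by ring
    simp only [this, Finset.sum_add_distrib, ← Finset.sum_mul, hbH']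
    rw [Matrix.one_apply_ne (Fin.castSucc_lt_last c).ne']
    field_simp
    ring
  · simp only [Fin.sum_univ_castSucc, hH₀, hw, hGb, hGA, Fin.snoc_last, Fin.snoc_castSucc]
    have : ∀ x, A a x * (0 + v x * -1 / s) = A a x * v x * (-1 / s) := fun x => by ring
    simp only [this, ← Finset.sum_mul, hAv']
    rw [Matrix.one_apply_ne (Fin.castSucc_lt_last a).ne]
    ring
  · simp only [Fin.sum_univ_castSucc, hH₀, hw, hGb, hGA, Fin.snoc_last, Fin.snoc_castSucc]
    have : ∀ x, A a x * (H x c + v x * v c / s) = A a x * H x c + A a x * v x * (v c / s) :=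
      fun x => by ring
    simp only [this, Finset.sum_add_distrib, ← Finset.sum_mul, hAv', hAH']
    simp only [Matrix.one_apply, Fin.castSucc_inj]
    ring

theorem mul_eval_invert {k : ℕ} {G : Fin k → Fin k → ℝ} (hG : (Matrix.of G).PosDef) :
    Matrix.of G * Matrix.of ((invert k G : Prog n₁ n₂ m ℝ _).eval M ω) = 1 := by
  induction k with
  | zero => ext i; exact i.elim0
  | succ k ih =>
    have hA := ih (G := fun a b => G a.castSucc b.castSucc)
      (hG.submatrix (Fin.castSucc_injective k))
    simp only [invert, eval_bind, eval_mulVec, eval_dot, eval, arithVal, eval_table]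
    -- The program forms `-1` as `0 - 1`.
    rw [zero_sub]
    exact bordering hG hA rfl rfl rfl rfl rfl

/-- Bordering from size `k` to `k + 1` costs `O(k²)`, below the increment `10 ((k + 1)³ - k³)`;
equality at `k = 0` fixes the constant. -/
theorem steps_invert_le {k : ℕ} (G : Fin k → Fin k → ℝ) :
    (invert k G : Prog n₁ n₂ m ℝ _).steps M ω ≤ 10 * k ^ 3 := by
  induction k with
  | zero => simp [invert, steps]
  | succ k ih =>
    simp only [invert, steps_bind, steps_mulVec, steps_dot, eval_mulVec, eval_dot, eval,
      steps, arithVal]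
    rw [steps_table (c := (k + 1) * 4)]
    · have := ih fun a b => G a.castSucc b.castSucc
      nlinarith
    · intro a
      rw [steps_table (c := 3)]
      intro c
      simp [steps]

theorem observations_invert {k : ℕ} (G : Fin k → Fin k → ℝ) :
    (invert k G : Prog n₁ n₂ m ℝ _).observations M ω = 0 := by
  induction k with
  | zero => simp [invert, observations]
  | succ k ih =>
    simp only [invert, observations_bind, observations_mulVec, observations_dot, eval, ih,
      observations]
    rw [observations_table (c := 0)]
    · simp
    intro a
    rw [observations_table (c := 0)]
    · simp
    intro c
    simp [observations]

/-! ### The list of sampled rows -/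

/-- The map `f` absorbs the shift of the loop index by `succ` in the induction; likewise in
`eval_collect`. -/
theorem eval_mark {k : ℕ} (f : Fin k → Fin m) (mark : Fin n₁ → Bool) (i : Fin n₁) :
    (loop k (fun t mark => do
        let i ← draw (f t) ret
        ret (Function.update mark i true)) mark :
      Prog n₁ n₂ m ℝ (Fin n₁ → Bool)).eval M ω i = true ↔ mark i = true ∨ ∃ t, ω (f t) = i := by
  induction k generalizing mark with
  | zero => simp [loop, eval]
  | succ k ih =>
    simp only [loop, eval, bind_eq, eval_bind]
    rw [ih (fun t => f t.succ), Fin.exists_fin_succ]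
    by_cases h : ω (f 0) = i
    · simp [h]
    · simp [h, Function.update_of_ne (Ne.symm h)]

theorem eval_collect {k : ℕ} (f : Fin k → Fin n₁) (mark : Fin n₁ → Bool) (l : List (Fin n₁)) :
    (loop k (fun i l => ret (if mark (f i) then l ++ [f i] else l)) l :
      Prog n₁ n₂ m ℝ (List (Fin n₁))).eval M ω = l ++ ((List.finRange k).map f).filter mark := by
  induction k generalizing l with
  | zero => simp [loop, eval]
  | succ k ih =>
    simp only [loop, eval, bind_eq, eval_bind]
    rw [ih (fun t => f t.succ), List.finRange_succ]
    by_cases h : mark (f 0) <;> simp [h, Function.comp_def]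

theorem eval_sampleRows : (sampleRows : Prog n₁ n₂ m ℝ _).eval M ω =
    (List.finRange n₁).filter fun i => decide (∃ t, ω t = i) := by
  simp only [sampleRows, eval_bind]
  rw [show ∀ mark : Fin n₁ → Bool, (loop n₁ (fun i l => ret (if mark i then l ++ [i] else l)) [] :
    Prog n₁ n₂ m ℝ (List (Fin n₁))).eval M ω = (List.finRange n₁).filter mark from fun mark => by
      simpa using eval_collect M ω id mark []]
  refine List.filter_congr fun i _ => ?_
  have := eval_mark M ω id ((table n₁ fun _ => ret false : Prog n₁ n₂ m ℝ _).eval M ω) i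
  rw [Bool.eq_iff_iff, decide_eq_true_iff]
  simpa [eval_table, eval] using this

theorem nodup_sampleRows :
    ((sampleRows : Prog n₁ n₂ m ℝ _).eval M ω).Nodup := by
  rw [eval_sampleRows]
  exact (List.nodup_finRange n₁).filter _

theorem mem_sampleRows (i : Fin n₁) :
    i ∈ (sampleRows : Prog n₁ n₂ m ℝ _).eval M ω ↔ ∃ t, ω t = i := by
  simp [eval_sampleRows]

/-- Because repetitions are removed, `m` does not enter the recurring cost `O(n₁ r)` of a column. -/
theorem length_sampleRows_le :
    ((sampleRows : Prog n₁ n₂ m ℝ _).eval M ω).length ≤ n₁ := by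
  simpa using (nodup_sampleRows M ω).length_le_card

theorem length_sampleRows_le_draws :
    ((sampleRows : Prog n₁ n₂ m ℝ _).eval M ω).length ≤ m := by
  rw [← List.toFinset_card_of_nodup (nodup_sampleRows M ω)]
  calc _ ≤ (Finset.univ.image ω).card := Finset.card_le_card fun i hi => by
        simpa [mem_sampleRows] using hi
    _ ≤ m := Finset.card_image_le.trans (by simp)

theorem steps_sampleRows :
    (sampleRows : Prog n₁ n₂ m ℝ _).steps M ω = 2 * n₁ + 2 * m := by
  simp only [sampleRows, steps_bind]
  rw [steps_table (c := 0), steps_loop (c := 1), steps_loop (c := 0)]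
  · ring
  all_goals intros; simp [steps]

theorem observations_sampleRows :
    (sampleRows : Prog n₁ n₂ m ℝ _).observations M ω = 0 := by
  simp only [sampleRows, observations_bind]
  rw [observations_table (c := 0), observations_loop, observations_loop]
  all_goals intros; simp [observations]

end Semantics

end Prog

/-! ### Vectors of a subspace that vanish at random coordinates -/

section Sampling

variable {n : ℕ}

/-- Both sides are the trace of the orthogonal projection onto `K`. -/
theorem sum_norm_sq_starProjection (K : Submodule ℝ (EuclideanSpace ℝ (Fin n))) :
    ∑ i, ‖K.starProjection (EuclideanSpace.single i (1 : ℝ))‖ ^ 2 = Module.finrank ℝ K := by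
  have hproj : LinearMap.IsProj K (K.starProjection : _ →ₗ[ℝ] EuclideanSpace ℝ (Fin n)) :=
    ⟨fun x => K.starProjection_apply_mem x, fun x hx => Submodule.starProjection_eq_self_iff.2 hx⟩
  rw [← hproj.trace, LinearMap.trace_eq_sum_inner _ (EuclideanSpace.basisFun (Fin n) ℝ)]
  refine Finset.sum_congr rfl fun i _ => ?_
  have := K.re_inner_starProjection_eq_normSq (𝕜 := ℝ) (EuclideanSpace.single i (1 : ℝ))
  rw [real_inner_comm]
  simpa using this.symm

/-- The vectors of `W` that vanish at the coordinates `ω t`. -/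
def vanishingOn (W : Submodule ℝ (EuclideanSpace ℝ (Fin n))) {m : ℕ} (ω : Fin m → Fin n) :
    Submodule ℝ (EuclideanSpace ℝ (Fin n)) where
  carrier := {x | x ∈ W ∧ ∀ t, x (ω t) = 0}
  add_mem' := fun ⟨h1, h2⟩ ⟨h3, h4⟩ => ⟨W.add_mem h1 h3, fun t => by simp [h2, h4]⟩
  zero_mem' := ⟨W.zero_mem, fun t => by simp⟩
  smul_mem' := fun c x ⟨h1, h2⟩ => ⟨W.smul_mem c h1, fun t => by simp [h2]⟩

theorem mem_vanishingOn {W : Submodule ℝ (EuclideanSpace ℝ (Fin n))} {m : ℕ} {ω : Fin m → Fin n}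
    {x : EuclideanSpace ℝ (Fin n)} : x ∈ vanishingOn W ω ↔ x ∈ W ∧ ∀ t, x (ω t) = 0 := Iff.rfl

theorem vanishingOn_le (W : Submodule ℝ (EuclideanSpace ℝ (Fin n))) {m : ℕ} (ω : Fin m → Fin n) :
    vanishingOn W ω ≤ W := fun _ hx => hx.1

/-- This passes the coherence bound from `W` to all its subspaces, in particular to those left after
some draws. -/
theorem norm_starProjection_le_of_le {K W : Submodule ℝ (EuclideanSpace ℝ (Fin n))} (h : K ≤ W)
    (x : EuclideanSpace ℝ (Fin n)) : ‖K.starProjection x‖ ≤ ‖W.starProjection x‖ := by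
  have := congrArg (fun f => f x) (Submodule.starProjection_comp_starProjection_of_le h)
  rw [← show K.starProjection (W.starProjection x) = K.starProjection x from this]
  exact K.norm_starProjection_apply_le _

/-- Either all of `K` vanishes at `i`, and then `e_i` is orthogonal to `K`; or the dimension drops
by at least one, and `B` dominates the squared norm. -/
theorem mul_finrank_vanishingOn_add_le {K : Submodule ℝ (EuclideanSpace ℝ (Fin n))} {B : ℝ}
    {i : Fin n} (hB : ‖K.starProjection (EuclideanSpace.single i (1 : ℝ))‖ ^ 2 ≤ B)
    {ω : Fin 1 → Fin n} (hω : ω 0 = i) :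
    B * Module.finrank ℝ (vanishingOn K ω) +
      ‖K.starProjection (EuclideanSpace.single i (1 : ℝ))‖ ^ 2 ≤ B * Module.finrank ℝ K := by
  subst hω
  have hB0 : 0 ≤ B := (sq_nonneg _).trans hB
  by_cases h : vanishingOn K ω = K
  · have h0 : K.starProjection (EuclideanSpace.single (ω 0) (1 : ℝ)) = 0 := by
      rw [Submodule.starProjection_apply_eq_zero_iff, Submodule.mem_orthogonal']
      intro u hu
      rw [← h] at hu
      simpa [EuclideanSpace.inner_single_left] using hu.2 0
    rw [h, h0]
    simp
  · have hlt := Submodule.finrank_lt_finrank_of_lt (lt_of_le_of_ne (vanishingOn_le K ω) h)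
    have : (Module.finrank ℝ (vanishingOn K ω) : ℝ) + 1 ≤ Module.finrank ℝ K := by
      exact_mod_cast hlt
    nlinarith

/-- The expected dimension of the space of vectors of `W` that vanish at all sampled coordinates
decreases by a constant factor with each draw. -/
theorem sum_finrank_vanishingOn_le {W : Submodule ℝ (EuclideanSpace ℝ (Fin n))} {B : ℝ}
    (hB : 0 < B) (hnB : 1 ≤ n * B)
    (h : ∀ i, ‖W.starProjection (EuclideanSpace.single i (1 : ℝ))‖ ^ 2 ≤ B) (m : ℕ) :
    ∑ ω : Fin m → Fin n, (Module.finrank ℝ (vanishingOn W ω) : ℝ) ≤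
      (n - 1 / B) ^ m * Module.finrank ℝ W := by
  have hc : 0 ≤ (n : ℝ) - 1 / B := by
    rw [sub_nonneg, div_le_iff₀ hB]; exact hnB
  induction m with
  | zero =>
    simp only [Finset.univ_unique, Finset.sum_singleton, pow_zero, one_mul]
    exact_mod_cast Submodule.finrank_mono (vanishingOn_le W _)
  | succ m ih =>
    have step : ∀ ω : Fin m → Fin n,
        ∑ i, (Module.finrank ℝ (vanishingOn W (Fin.cons i ω : Fin (m + 1) → Fin n)) : ℝ) ≤
          (n - 1 / B) * Module.finrank ℝ (vanishingOn W ω) := by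
      intro ω
      set K := vanishingOn W ω with hK
      -- Draws can be imposed one after another: the new coordinate cuts down the space left by `ω`.
      have hcons : ∀ i, vanishingOn W (Fin.cons i ω : Fin (m + 1) → Fin n) =
          vanishingOn K (fun _ : Fin 1 => i) := by
        intro i
        ext x
        rw [mem_vanishingOn, mem_vanishingOn, hK, mem_vanishingOn, Fin.forall_fin_succ]
        simp only [Fin.cons_zero, Fin.cons_succ, Fin.forall_fin_one]
        tauto
      have hsum : ∑ i, (B * (Module.finrank ℝ (vanishingOn K (fun _ : Fin 1 => i)) : ℝ) +
          ‖K.starProjection (EuclideanSpace.single i (1 : ℝ))‖ ^ 2) ≤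
          ∑ _i : Fin n, B * (Module.finrank ℝ K : ℝ) :=
        Finset.sum_le_sum fun i _ => mul_finrank_vanishingOn_add_le
          ((pow_le_pow_left₀ (norm_nonneg _)
            (norm_starProjection_le_of_le (vanishingOn_le W ω) _) 2).trans (h i)) rfl
      rw [Finset.sum_add_distrib, sum_norm_sq_starProjection, ← Finset.mul_sum] at hsum
      rw [Finset.sum_congr rfl fun i _ => show
        (Module.finrank ℝ (vanishingOn W (Fin.cons i ω : Fin (m + 1) → Fin n)) : ℝ) =
          Module.finrank ℝ (vanishingOn K fun _ : Fin 1 => i) by rw [hcons i]]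
      rw [← mul_le_mul_iff_right₀ hB]
      simp only [Finset.sum_const, Finset.card_univ, Fintype.card_fin, nsmul_eq_mul] at hsum
      have : B * ((n - 1 / B) * (Module.finrank ℝ K : ℝ)) =
          n * (B * Module.finrank ℝ K) - Module.finrank ℝ K := by
        field_simp
      linarith
    rw [← (Fin.consEquiv fun _ : Fin (m + 1) => Fin n).sum_comp, Fintype.sum_prod_type,
      Finset.sum_comm]
    calc _ ≤ ∑ ω : Fin m → Fin n, ((n : ℝ) - 1 / B) * Module.finrank ℝ (vanishingOn W ω) :=
          Finset.sum_le_sum fun ω _ => step ω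
      _ ≤ (n - 1 / B) * ((n - 1 / B) ^ m * Module.finrank ℝ W) := by
          rw [← Finset.mul_sum]
          exact mul_le_mul_of_nonneg_left ih hc
      _ = _ := by ring

theorem norm_sq_starProjection_le_of_coherence_le {W : Submodule ℝ (EuclideanSpace ℝ (Fin n))}
    {μ₀ : ℝ} (hW : 0 < Module.finrank ℝ W) (h : coherence W ≤ μ₀) (i : Fin n) :
    ‖W.starProjection (EuclideanSpace.single i (1 : ℝ))‖ ^ 2 ≤ Module.finrank ℝ W * μ₀ / n := by
  have hn : (0 : ℝ) < n := by exact_mod_cast i.pos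
  have hd : (0 : ℝ) < Module.finrank ℝ W := by exact_mod_cast hW
  have h1 : ‖W.starProjection (EuclideanSpace.single i (1 : ℝ))‖ ^ 2 ≤
      ⨆ j : Fin n, ‖W.starProjection (EuclideanSpace.single j (1 : ℝ))‖ ^ 2 :=
    le_ciSup (f := fun j : Fin n => ‖W.starProjection (EuclideanSpace.single j (1 : ℝ))‖ ^ 2)
      (Set.finite_range _).bddAbove i
  refine h1.trans ?_
  unfold coherence at h
  rw [div_mul_eq_mul_div, div_le_iff₀ hd] at h
  rw [le_div_iff₀ hn]
  linarith

/-- The probability that some nonzero vector of `W` vanishes at all sampled coordinates. -/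
theorem card_vanishingOn_ne_bot_le {W : Submodule ℝ (EuclideanSpace ℝ (Fin n))} {μ₀ : ℝ}
    (hW : 0 < Module.finrank ℝ W) (h : coherence W ≤ μ₀) (m : ℕ) :
    1 ≤ μ₀ ∧ ((Set.ncard {ω : Fin m → Fin n | vanishingOn W ω ≠ ⊥} : ℕ) : ℝ) ≤
      n ^ m * (Module.finrank ℝ W * Real.exp (-(m / (Module.finrank ℝ W * μ₀)))) := by
  classical
  set d := Module.finrank ℝ W with hd
  have hdn : d ≤ n := by simpa using Submodule.finrank_le W
  have hd1 : (1 : ℝ) ≤ d := by exact_mod_cast hW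
  have hn : (0 : ℝ) < n := by exact_mod_cast hW.trans_le hdn
  have hB := norm_sq_starProjection_le_of_coherence_le hW h
  -- The average of `‖P_W e_i‖²` over `i` is `d / n`, which cannot exceed the bound `d μ₀ / n`.
  have hμ : 1 ≤ μ₀ := by
    have : ∑ i, ‖W.starProjection (EuclideanSpace.single i (1 : ℝ))‖ ^ 2 ≤
        ∑ _i : Fin n, (d * μ₀ / n : ℝ) := Finset.sum_le_sum fun i _ => hB i
    rw [sum_norm_sq_starProjection, ← hd] at this
    simp only [Finset.sum_const, Finset.card_univ, Fintype.card_fin, nsmul_eq_mul] at this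
    rw [mul_div_cancel₀ _ hn.ne'] at this
    nlinarith
  refine ⟨hμ, ?_⟩
  have hBpos : 0 < d * μ₀ / n := by positivity
  have hnB : 1 ≤ n * (d * μ₀ / n) := by
    rw [mul_div_cancel₀ _ hn.ne']
    nlinarith
  have key := sum_finrank_vanishingOn_le hBpos hnB hB m
  -- Markov's inequality: a nonzero space has dimension at least one.
  have hcard : ((Set.ncard {ω : Fin m → Fin n | vanishingOn W ω ≠ ⊥} : ℕ) : ℝ) ≤
      ∑ ω : Fin m → Fin n, (Module.finrank ℝ (vanishingOn W ω) : ℝ) := by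
    rw [Set.ncard_eq_toFinset_card', Finset.card_eq_sum_ones, Nat.cast_sum]
    refine (Finset.sum_le_sum fun ω hω => ?_).trans
      (Finset.sum_le_univ_sum_of_nonneg fun ω => Nat.cast_nonneg _)
    have : vanishingOn W ω ≠ ⊥ := by simpa using hω
    have := Nat.one_le_iff_ne_zero.2 (mt Submodule.finrank_eq_zero.1 this)
    exact_mod_cast this
  have hfac : (n : ℝ) - 1 / (d * μ₀ / n) = n * (1 - 1 / (d * μ₀)) := by
    field_simp
  have hdμ : 1 ≤ d * μ₀ := by nlinarith
  calc _ ≤ _ := hcard.trans key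
    _ = n ^ m * (d * (1 - 1 / (d * μ₀)) ^ m) := by rw [hfac, mul_pow, ← hd]; ring
    _ ≤ n ^ m * (d * Real.exp (-(1 / (d * μ₀))) ^ m) := by
        gcongr
        · rw [sub_nonneg, div_le_one (by positivity)]; exact hdμ
        · exact Real.one_sub_le_exp_neg _
    _ = _ := by
        rw [← Real.exp_nat_mul]
        congr 3
        ring

end Sampling

namespace Prog

/-! ### The invariant and the cost of the algorithm -/

section Completion

variable {n₁ n₂ m : ℕ} (M : Matrix (Fin n₁) (Fin n₂) ℝ) (ω : Fin m → Fin n₁)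

/-- The basis vectors of a candidate, restricted to the sampled rows, as the rows of a matrix. -/
def Candidate.restrict {s : ℕ} (Ω : Fin s → Fin n₁) (c : Candidate n₁ ℝ) :
    Matrix (Fin c.d) (Fin s) ℝ := Matrix.of fun a t => c.U a (Ω t)

/-- The invariant of the algorithm: the candidate space lies in `W`, restriction to the sampled rows
is injective on it, and `H` is the inverse of the Gram matrix. -/
structure Candidate.Valid {s : ℕ} (Ω : Fin s → Fin n₁) (W : Submodule ℝ (Fin n₁ → ℝ))
    (c : Candidate n₁ ℝ) : Prop where
  mem : ∀ a, c.U a ∈ W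
  indep : LinearIndependent ℝ (c.restrict Ω).row
  inverse : c.restrict Ω * (c.restrict Ω)ᵀ * Matrix.of c.H = 1

variable {s : ℕ} {Ω : Fin s → Fin n₁} {W : Submodule ℝ (Fin n₁ → ℝ)} {c : Candidate n₁ ℝ}

theorem Candidate.valid_empty : (Candidate.empty : Candidate n₁ ℝ).Valid Ω W :=
  ⟨fun a => a.elim0, linearIndependent_empty_type (ι := Fin 0), Matrix.ext fun a => a.elim0⟩

namespace Candidate.Valid

theorem dim_le_finrank (h : c.Valid Ω W) : c.d ≤ Module.finrank ℝ W := by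
  have h1 : LinearIndependent ℝ fun a : Fin c.d => (⟨c.U a, h.mem a⟩ : W) := by
    refine LinearIndependent.of_comp
      ((LinearMap.funLeft ℝ ℝ Ω).comp W.subtype) ?_
    exact h.indep
  simpa using h1.fintype_card_le_finrank

/-- With `s ≤ n₁` this absorbs `d²` into `n₁ r`; after an extension it absorbs the cubic cost of
inversion into `r² s`. -/
theorem dim_le_sample (h : c.Valid Ω W) : c.d ≤ s := by
  simpa using h.indep.fintype_card_le_finrank

/-- The residual of a sampled vector in the span of the restricted basis vanishes. -/
theorem residual_eq_zero (h : c.Valid Ω W) (z : Fin c.d → ℝ) :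
    (c.restrict Ω)ᵀ *ᵥ (Matrix.of c.H *ᵥ (c.restrict Ω *ᵥ ((c.restrict Ω)ᵀ *ᵥ z))) =
      (c.restrict Ω)ᵀ *ᵥ z := by
  congr 1
  rw [Matrix.mulVec_mulVec, Matrix.mulVec_mulVec, Matrix.mul_assoc,
    mul_eq_one_comm.mp h.inverse, Matrix.one_mulVec]

end Candidate.Valid

theorem posDef_gram {d : ℕ} {A : Matrix (Fin d) (Fin s) ℝ} (hA : LinearIndependent ℝ A.row) :
    (A * Aᵀ).PosDef := by
  have := Matrix.PosDef.mul_conjTranspose_self A (Matrix.vecMul_injective_iff.2 hA)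
  rwa [Matrix.conjTranspose_eq_transpose_of_trivial] at this

/-- Extending a candidate by a column whose sampled part is new. -/
theorem valid_extend (h : c.Valid Ω W) {x : Fin n₁ → ℝ} (hx : x ∈ W)
    (hnew : ∀ z, (c.restrict Ω)ᵀ *ᵥ z ≠ fun t => x (Ω t)) :
    ((extend Ω c x : Prog n₁ n₂ m ℝ _).eval M ω).Valid Ω W := by
  simp only [extend, eval_bind, eval_mulVec, eval_vecSub, eval_dot, eval_table, eval, arithVal]
  set b := Matrix.mulVec c.U x
  set w := x - Matrix.mulVec (fun i a => c.U a i) b with hw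
  have hcomb : ∀ z : Fin c.d → ℝ, Matrix.mulVec (fun i a => c.U a i) z = ∑ a, z a • c.U a := by
    intro z
    ext i
    simp [Matrix.mulVec, dotProduct, mul_comm]
  -- Otherwise `x` lies in the candidate space, and its sampled part in the restricted span.
  have hw0 : w ≠ 0 := fun h0 => by
    refine hnew b (funext fun t => ?_)
    rw [hw, sub_eq_zero] at h0
    exact (congrFun h0 (Ω t)).symm
  have hnrm : Real.sqrt (w ⬝ᵥ w) ≠ 0 := by
    rw [Real.sqrt_ne_zero']
    exact lt_of_le_of_ne (Finset.sum_nonneg fun i _ => mul_self_nonneg _)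
      fun h0 => hw0 (dotProduct_self_eq_zero.1 h0.symm)
  set ν := Real.sqrt (w ⬝ᵥ w)
  have hu : (fun i => w i / ν) = ν⁻¹ • w := by
    ext i
    simp [div_eq_inv_mul]
  have hwW : w ∈ W := by
    refine W.sub_mem hx ?_
    rw [hcomb]
    exact W.sum_mem fun a _ => W.smul_mem _ (h.mem a)
  set U' : Fin (c.d + 1) → Fin n₁ → ℝ :=
    Fin.snoc (α := fun _ => Fin n₁ → ℝ) c.U (fun i => w i / ν) with hU'
  set A : Matrix (Fin (c.d + 1)) (Fin s) ℝ := Matrix.of fun a t => U' a (Ω t) with hA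
  have hindep : LinearIndependent ℝ A.row := by
    have hrow : A.row = Fin.snoc (α := fun _ => Fin s → ℝ) (c.restrict Ω).row
        (fun t => w (Ω t) / ν) := by
      funext a
      refine Fin.lastCases ?_ (fun a => ?_) a
      · rw [Fin.snoc_last]
        funext t
        simp [hA, hU', Matrix.row]
      · rw [Fin.snoc_castSucc]
        funext t
        simp [hA, hU', Matrix.row, Candidate.restrict]
    rw [hrow, linearIndependent_finSnoc]
    refine ⟨h.indep, fun hmem => ?_⟩
    obtain ⟨z, hz⟩ := (Submodule.mem_span_range_iff_exists_fun ℝ).1 hmem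
    -- If `w_Ω / ν` were the combination `z` of the restricted basis, then `x_Ω` would be the
    -- combination `b + ν z`.
    refine hnew (b + ν • z) (funext fun t => ?_)
    have hzt := congrFun hz t
    simp only [Finset.sum_apply, Pi.smul_apply, smul_eq_mul, Matrix.row_apply] at hzt
    rw [Matrix.mulVec_add, Matrix.mulVec_smul]
    have h1 : ((c.restrict Ω)ᵀ *ᵥ b) t = x (Ω t) - w (Ω t) := by
      rw [hw]
      simp [Matrix.mulVec, dotProduct, Candidate.restrict]
    have h2 : ((c.restrict Ω)ᵀ *ᵥ z) t = w (Ω t) / ν := by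
      rw [← hzt]
      simp [Matrix.mulVec, dotProduct, mul_comm]
    rw [Pi.add_apply, Pi.smul_apply, h1, h2, smul_eq_mul]
    field_simp
    ring
  refine ⟨fun a => ?_, hindep, ?_⟩
  · change U' a ∈ W
    refine Fin.lastCases ?_ (fun a => ?_) a
    · simp only [hU', Fin.snoc_last, hu]
      exact W.smul_mem _ hwW
    · simp only [hU', Fin.snoc_castSucc]
      exact h.mem a
  · have := mul_eval_invert M ω (G := fun a a' => (fun t => U' a (Ω t)) ⬝ᵥ fun t => U' a' (Ω t))
      (posDef_gram hindep)
    exact this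

@[simp] theorem dim_extend (x : Fin n₁ → ℝ) :
    ((extend Ω c x : Prog n₁ n₂ m ℝ _).eval M ω).d = c.d + 1 := by
  simp only [extend, eval_bind, eval]

theorem steps_extend_le (x : Fin n₁ → ℝ) :
    (extend Ω c x : Prog n₁ n₂ m ℝ _).steps M ω ≤
      c.d * (3 * n₁ + 2) + n₁ * (3 * c.d + 2) + 7 * n₁ + 2 +
        (c.d + 1) * ((c.d + 1) * (3 * s + 2) + 1) + 10 * (c.d + 1) ^ 3 := by
  simp only [extend, steps_bind, eval_mulVec, eval_vecSub, eval_dot, eval, steps,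
    steps_mulVec, steps_vecSub, steps_dot]
  rw [steps_table (c := 1) M ω fun _ => by simp [steps],
    steps_table (c := (c.d + 1) * (3 * s + 2)) M ω fun a =>
      steps_table (c := 3 * s + 1) M ω fun a' => by simp]
  have := fun G => steps_invert_le (k := c.d + 1) M ω G
  -- Only the inversion cost, deep in the nested sum, is an inequality; the remaining terms are
  -- exact.
  refine (Nat.add_le_add_left (Nat.add_le_add_left (Nat.add_le_add_left (Nat.add_le_add_left
    (Nat.add_le_add_left (Nat.add_le_add_left (Nat.add_le_add_left (Nat.add_le_add_right
      (this _) _) _) _) _) _) _) _) _).trans ?_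
  apply le_of_eq
  ring

theorem observations_extend (x : Fin n₁ → ℝ) :
    (extend Ω c x : Prog n₁ n₂ m ℝ _).observations M ω = 0 := by
  simp only [extend, observations_bind, observations_mulVec, observations_vecSub,
    observations_dot, observations, observations_invert]
  rw [observations_table (c := 0) M ω fun _ => by simp [observations],
    observations_table (c := 0) M ω fun a =>
      (observations_table (c := 0) M ω fun a' => by simp).trans (by simp)]
  simp

/-- The coefficients that the algorithm computes for column `j`. -/
def coefficients (Ω : Fin s → Fin n₁) (j : Fin n₂) (c : Candidate n₁ ℝ) : Fin c.d → ℝ :=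
  Matrix.of c.H *ᵥ (c.restrict Ω *ᵥ fun t => M (Ω t) j)

/-- The residual of column `j` in the sampled rows. -/
def residual (Ω : Fin s → Fin n₁) (j : Fin n₂) (c : Candidate n₁ ℝ) : Fin s → ℝ :=
  (fun t => M (Ω t) j) - (c.restrict Ω)ᵀ *ᵥ coefficients M Ω j c

theorem dotProduct_residual_pos_iff (j : Fin n₂) :
    0 < residual M Ω j c ⬝ᵥ residual M Ω j c ↔ residual M Ω j c ≠ 0 := by
  constructor
  · rintro h h0
    simp [h0] at h
  · exact fun h => lt_of_le_of_ne (Finset.sum_nonneg fun i _ => mul_self_nonneg _)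
      fun h0 => h (dotProduct_self_eq_zero.1 h0.symm)

theorem column_of_residual_eq_zero {j : Fin n₂} (h : residual M Ω j c = 0) :
    (column Ω j c : Prog n₁ n₂ m ℝ _).eval M ω =
        (Matrix.mulVec (fun i a => c.U a i) (coefficients M Ω j c), c) ∧
      (column Ω j c : Prog n₁ n₂ m ℝ _).steps M ω =
        s * 2 + c.d * (3 * s + 2) + c.d * (3 * c.d + 2) + s * (3 * c.d + 2) + s * 2 +
          (3 * s + 1) + 1 + n₁ * (3 * c.d + 2) ∧
      (column Ω j c : Prog n₁ n₂ m ℝ _).observations M ω = s := by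
  have hnot : ¬ 0 < residual M Ω j c ⬝ᵥ residual M Ω j c := by simp [h]
  have hd : decide (0 < ((fun t => M (Ω t) j) - Matrix.mulVec (fun t a => c.U a (Ω t))
      (Matrix.mulVec c.H (Matrix.mulVec (fun a t => c.U a (Ω t)) fun t => M (Ω t) j))) ⬝ᵥ
      ((fun t => M (Ω t) j) - Matrix.mulVec (fun t a => c.U a (Ω t))
      (Matrix.mulVec c.H (Matrix.mulVec (fun a t => c.U a (Ω t)) fun t => M (Ω t) j)))) = false :=
    decide_eq_false hnot
  refine ⟨?_, ?_, ?_⟩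
  · simp only [column, eval_bind, eval_table, eval, eval_mulVec, eval_vecSub, eval_dot, hd,
      Bool.false_eq_true, if_false]
    rfl
  · simp only [column, eval_table, eval, eval_mulVec, eval_vecSub, eval_dot, hd,
      steps_bind, steps_mulVec, steps_vecSub, steps_dot, steps, Bool.false_eq_true, if_false]
    rw [steps_table (c := 1) M ω fun _ => by simp [steps]]
    ring
  · simp only [column, eval_table, eval, eval_mulVec, eval_vecSub, eval_dot, hd,
      observations_bind, observations_mulVec, observations_vecSub, observations_dot, observations,
      Bool.false_eq_true, if_false]
    rw [observations_table (c := 1) M ω fun _ => by simp [observations]]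
    ring

theorem column_of_residual_ne_zero {j : Fin n₂} (h : residual M Ω j c ≠ 0) :
    (column Ω j c : Prog n₁ n₂ m ℝ _).eval M ω =
        (fun i => M i j, (extend Ω c (fun i => M i j) : Prog n₁ n₂ m ℝ _).eval M ω) ∧
      (column Ω j c : Prog n₁ n₂ m ℝ _).steps M ω =
        s * 2 + c.d * (3 * s + 2) + c.d * (3 * c.d + 2) + s * (3 * c.d + 2) + s * 2 +
          (3 * s + 1) + 1 + n₁ * 2 +
          (extend Ω c (fun i => M i j) : Prog n₁ n₂ m ℝ _).steps M ω ∧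
      (column Ω j c : Prog n₁ n₂ m ℝ _).observations M ω = s + n₁ := by
  have hd : decide (0 < ((fun t => M (Ω t) j) - Matrix.mulVec (fun t a => c.U a (Ω t))
      (Matrix.mulVec c.H (Matrix.mulVec (fun a t => c.U a (Ω t)) fun t => M (Ω t) j))) ⬝ᵥ
      ((fun t => M (Ω t) j) - Matrix.mulVec (fun t a => c.U a (Ω t))
      (Matrix.mulVec c.H (Matrix.mulVec (fun a t => c.U a (Ω t)) fun t => M (Ω t) j)))) = true :=
    decide_eq_true ((dotProduct_residual_pos_iff M j).2 h)
  refine ⟨?_, ?_, ?_⟩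
  · simp only [column, eval_bind, eval_table, eval, eval_mulVec, eval_vecSub, eval_dot, hd,
      if_true]
  · simp only [column, eval_table, eval, eval_mulVec, eval_vecSub, eval_dot, hd,
      steps_bind, steps_mulVec, steps_vecSub, steps_dot, steps, if_true]
    rw [steps_table (c := 1) M ω fun _ => by simp [steps],
      steps_table (c := 1) M ω fun _ => by simp [steps]]
    ring
  · simp only [column, eval_table, eval, eval_mulVec, eval_vecSub, eval_dot, hd,
      observations_bind, observations_mulVec, observations_vecSub, observations_dot, observations,
      observations_extend, if_true]
    rw [observations_table (c := 1) M ω fun _ => by simp [observations],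
      observations_table (c := 1) M ω fun _ => by simp [observations]]
    ring

/-- A column costs `O(n₁ r)` apart from the Gram matrix and its inversion. These cost `O(r² s)`,
occur only when the dimension rises by one, and are paid for by the potential; so is a full
observation. -/
theorem column_spec (h : c.Valid Ω W) {j : Fin n₂} (hj : (fun i => M i j) ∈ W)
    {r : ℕ} (hr : Module.finrank ℝ W ≤ r) (hr0 : 0 < r) (hn : 0 < n₁) (hs : s ≤ n₁) :
    (((column Ω j c : Prog n₁ n₂ m ℝ _).eval M ω).2).Valid Ω W ∧
      ((∀ x ∈ W, (∀ t, x (Ω t) = 0) → x = 0) →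
        ((column Ω j c : Prog n₁ n₂ m ℝ _).eval M ω).1 = fun i => M i j) ∧
      (column Ω j c : Prog n₁ n₂ m ℝ _).steps M ω + 16 * r ^ 2 * s * c.d ≤
        50 * n₁ * r + 16 * r ^ 2 * s * ((column Ω j c : Prog n₁ n₂ m ℝ _).eval M ω).2.d ∧
      (column Ω j c : Prog n₁ n₂ m ℝ _).observations M ω + n₁ * c.d ≤
        s + n₁ * ((column Ω j c : Prog n₁ n₂ m ℝ _).eval M ω).2.d := by
  have hd := h.dim_le_finrank.trans hr
  have hds := h.dim_le_sample
  have e7 : 1 ≤ n₁ * r := Nat.mul_pos hn hr0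
  have e1 : s * 1 ≤ n₁ * r := Nat.mul_le_mul hs hr0
  have e2 : c.d * s ≤ n₁ * r := by rw [mul_comm]; exact Nat.mul_le_mul hs hd
  have e3 : c.d * c.d ≤ n₁ * r := Nat.mul_le_mul (hds.trans hs) hd
  have e4 : c.d * 1 ≤ n₁ * r := Nat.mul_le_mul (hds.trans hs) hr0
  have e5 : n₁ * 1 ≤ n₁ * r := Nat.mul_le_mul le_rfl hr0
  have e6 : n₁ * c.d ≤ n₁ * r := Nat.mul_le_mul le_rfl hd
  by_cases hres : residual M Ω j c = 0
  · obtain ⟨h1, h2, h3⟩ := column_of_residual_eq_zero (m := m) M ω hres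
    rw [h1, h2, h3]
    refine ⟨h, fun hinj => ?_, ?_, le_rfl⟩
    · set z := coefficients M Ω j c
      have hcomb : Matrix.mulVec (fun i a => c.U a i) z ∈ W := by
        have : Matrix.mulVec (fun i a => c.U a i) z = ∑ a, z a • c.U a := by
          ext i
          simp [Matrix.mulVec, dotProduct, mul_comm]
        rw [this]
        exact W.sum_mem fun a _ => W.smul_mem _ (h.mem a)
      -- The error of the estimate is a vector of `W` that vanishes on `Ω`.
      refine (sub_eq_zero.1 (hinj _ (W.sub_mem hj hcomb) fun t => ?_)).symm
      exact congrFun hres t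
    · nlinarith
  · obtain ⟨h1, h2, h3⟩ := column_of_residual_ne_zero (m := m) M ω hres
    have hnew : ∀ z, (c.restrict Ω)ᵀ *ᵥ z ≠ fun t => M (Ω t) j := fun z hz => by
      refine hres ?_
      rw [residual, coefficients, ← hz, h.residual_eq_zero, sub_self]
    have hval := valid_extend (m := m) M ω h hj hnew
    have hd' := hval.dim_le_finrank.trans hr
    have hds' := hval.dim_le_sample
    have hext := steps_extend_le (m := m) (Ω := Ω) (c := c) M ω fun i => M i j
    rw [h1, h2, h3]
    rw [dim_extend] at hd' hds' ⊢
    refine ⟨hval, fun _ => rfl, ?_, by linarith⟩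
    -- The Gram matrix costs `3(d+1)²s + 2(d+1)² + (d+1)` and the inversion at most `10(d+1)³`;
    -- hence `16 = 3 + 2 + 1 + 10`.
    have f1 : (c.d + 1) * (c.d + 1) ≤ r ^ 2 := by rw [sq]; exact Nat.mul_le_mul hd' hd'
    have f2 : (c.d + 1) * (c.d + 1) * s ≤ r ^ 2 * s := Nat.mul_le_mul f1 le_rfl
    have f3 : (c.d + 1) * (c.d + 1) * (c.d + 1) ≤ r ^ 2 * s := Nat.mul_le_mul f1 hds'
    have f4 : (c.d + 1) * (c.d + 1) * 1 ≤ r ^ 2 * s := Nat.mul_le_mul f1 (by omega)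
    have f5 : (c.d + 1) * 1 ≤ r ^ 2 * s := by nlinarith
    nlinarith

/-- The potential `d` starts at `0` and never exceeds `r`, so all extensions together cost at most
`16 r³ m` steps and `r n₁` observations. -/
theorem sequentialCompletion_spec {W : Submodule ℝ (Fin n₁ → ℝ)} (hM : ∀ j, (fun i => M i j) ∈ W)
    {r : ℕ} (hr : Module.finrank ℝ W ≤ r) (hr0 : 0 < r) (hn : 0 < n₁) :
    ((∀ x ∈ W, (∀ t, x (ω t) = 0) → x = 0) →
        (sequentialCompletion n₁ n₂ m ℝ).eval M ω = M) ∧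
      (sequentialCompletion n₁ n₂ m ℝ).steps M ω ≤
        2 * n₁ + 2 * m + n₂ * (50 * n₁ * r + 1) + 16 * r ^ 3 * m ∧
      (sequentialCompletion n₁ n₂ m ℝ).observations M ω ≤ n₂ * m + r * n₁ := by
  set l := (sampleRows : Prog n₁ n₂ m ℝ _).eval M ω with hl
  have hln : l.length ≤ n₁ := length_sampleRows_le M ω
  have hlm : l.length ≤ m := length_sampleRows_le_draws M ω
  obtain ⟨h1, h2, h3, h4⟩ := mapLoop_spec (m := m) M ω
    (body := fun j c => column (m := m) (n₂ := n₂) l.get j c)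
    (I := fun c => c.Valid l.get W)
    (Q := fun j v => (∀ x ∈ W, (∀ t, x (l.get t) = 0) → x = 0) → v = fun i => M i j)
    (φ := fun c => c.d)
    (fun j c hc => (column_spec M ω hc (hM j) hr hr0 hn hln).1)
    (fun j c hc => (column_spec M ω hc (hM j) hr hr0 hn hln).2.1)
    (fun j c hc => (column_spec M ω hc (hM j) hr hr0 hn hln).2.2.1)
    (fun j c hc => (column_spec M ω hc (hM j) hr hr0 hn hln).2.2.2)
    Candidate.empty Candidate.valid_empty
  have hd := h1.dim_le_finrank.trans hr
  simp only [sequentialCompletion, eval_bind, steps_bind, observations_bind, eval, steps,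
    observations, steps_sampleRows, observations_sampleRows]
  refine ⟨fun hinj => ?_, ?_, ?_⟩
  · ext i j
    refine congrFun (h2 j fun x hx hx0 => hinj x hx fun t => ?_) i
    obtain ⟨u, hu⟩ := List.mem_iff_get.1 ((mem_sampleRows M ω (ω t)).2 ⟨t, rfl⟩)
    rw [← hu]
    exact hx0 u
  · have : 16 * r ^ 2 * l.length *
        ((mapLoop n₂ (fun j c => column (m := m) l.get j c) Candidate.empty).eval M ω).2.d ≤
        16 * r ^ 2 * m * r := Nat.mul_le_mul (Nat.mul_le_mul le_rfl hlm) hd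
    have e : 16 * r ^ 2 * m * r = 16 * r ^ 3 * m := by ring
    have : 2 * n₁ + 2 * m +
        ((mapLoop n₂ (fun j c => column (m := m) l.get j c) Candidate.empty).steps M ω + 0) ≤
        2 * n₁ + 2 * m + n₂ * (50 * n₁ * r + 1) + 16 * r ^ 3 * m := by omega
    exact this
  · have : n₁ * ((mapLoop n₂ (fun j c => column (m := m) l.get j c)
        Candidate.empty).eval M ω).2.d ≤ n₁ * r := Nat.mul_le_mul le_rfl hd
    have e : n₂ * l.length ≤ n₂ * m := Nat.mul_le_mul le_rfl hlm
    have e' : n₁ * r = r * n₁ := mul_comm _ _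
    have : 0 + ((mapLoop n₂ (fun j c => column (m := m) l.get j c)
        Candidate.empty).observations M ω + 0) ≤ n₂ * m + r * n₁ := by omega
    exact this

end Completion

end Prog

/-! ### From the singular value decomposition to the theorem -/

theorem finrank_columnSpan {n d : ℕ} {U : Matrix (Fin n) (Fin d) ℝ} (hU : Uᵀ * U = 1) :
    Module.finrank ℝ (columnSpan U) = d := by
  have : LinearIndependent ℝ fun a : Fin d => WithLp.toLp 2 (fun i => U i a) := by
    have h : LinearIndependent ℝ U.col := by
      rw [← Matrix.mulVec_injective_iff]
      intro x y hxy
      have := congrArg (Uᵀ *ᵥ ·) hxy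
      simpa [Matrix.mulVec_mulVec, hU] using this
    exact h.map' (WithLp.linearEquiv 2 ℝ (Fin n → ℝ)).symm.toLinearMap
      (LinearEquiv.ker _)
  rw [columnSpan, finrank_span_eq_card this, Fintype.card_fin]

theorem toLp_mulVec_mem_columnSpan {n d : ℕ} (U : Matrix (Fin n) (Fin d) ℝ) (x : Fin d → ℝ) :
    WithLp.toLp 2 (U *ᵥ x) ∈ columnSpan U := by
  have : WithLp.toLp 2 (U *ᵥ x) = ∑ a, x a • WithLp.toLp 2 (fun i => U i a) := by
    ext i
    simp [Matrix.mulVec, dotProduct, mul_comm]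
  rw [this]
  exact Submodule.sum_mem _ fun a _ =>
    Submodule.smul_mem _ _ (Submodule.subset_span ⟨a, rfl⟩)

theorem measureReal_uniformOn_univ {Ω : Type*} [Fintype Ω] [Nonempty Ω] [MeasurableSpace Ω]
    [MeasurableSingletonClass Ω] (s : Set Ω) :
    (uniformOn (Set.univ : Set Ω)).real s = s.ncard / Fintype.card Ω := by
  rw [measureReal_def, uniformOn_univ, Measure.count_apply (Set.toFinite s).measurableSet,
    ← Set.Finite.cast_ncard_eq (Set.toFinite s), ENat.toENNReal_coe, ENNReal.toReal_div,
    ENNReal.toReal_natCast, ENNReal.toReal_natCast]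

/-- The failure probability at the prescribed number of draws. -/
theorem mul_exp_neg_le {r m : ℕ} {μ₀ δ : ℝ} (hr : 0 < r) (hμ : 1 ≤ μ₀) (hδ : 0 < δ) (hδ1 : δ < 1)
    (hm : 36 * (r : ℝ) ^ (3 / 2 : ℝ) * μ₀ * Real.log (2 * r / δ) ≤ m) :
    r * Real.exp (-(m / (r * μ₀))) ≤ 4 * r * δ - δ := by
  have hr1 : (1 : ℝ) ≤ r := by exact_mod_cast hr
  have hlog : 0 < Real.log (2 * r / δ) := by
    apply Real.log_pos
    rw [lt_div_iff₀ hδ]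
    linarith
  -- Only `m ≥ r μ₀ log(2r/δ)` is needed, which is weaker than the hypothesis.
  have hpow : (r : ℝ) ≤ (r : ℝ) ^ (3 / 2 : ℝ) := by
    nth_rewrite 1 [← Real.rpow_one (r : ℝ)]
    exact Real.rpow_le_rpow_of_exponent_le hr1 (by norm_num)
  have h1 : Real.log (2 * r / δ) ≤ m / (r * μ₀) := by
    rw [le_div_iff₀ (by positivity)]
    refine le_trans ?_ hm
    have : (r : ℝ) * μ₀ ≤ 36 * (r : ℝ) ^ (3 / 2 : ℝ) * μ₀ := by
      gcongr
      linarith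
    nlinarith
  have h2 : Real.exp (-(m / (r * μ₀))) ≤ δ / (2 * r) := by
    calc _ ≤ Real.exp (-Real.log (2 * r / δ)) := Real.exp_le_exp.2 (by linarith)
      _ = δ / (2 * r) := by rw [Real.exp_neg, Real.exp_log (by positivity), inv_div]
  calc r * Real.exp (-(m / (r * μ₀))) ≤ r * (δ / (2 * r)) := by gcongr
    _ = δ / 2 := by field_simp
    _ ≤ 4 * r * δ - δ := by nlinarith

/-- `M = U Σ Vᵀ` is a (compact) singular value decomposition of the rank `r` matrix `M`, with
`Σ = diag σ`. The sample `ω` consists of `m` independent uniform draws of a row index. The constant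
`C` of the running time is absolute, and the running time is bounded for every outcome `ω`. -/
theorem corollary1 :
    ∃ C : ℝ, ∀ (n₁ n₂ r m : ℕ) (M : Matrix (Fin n₁) (Fin n₂) ℝ)
      (U : Matrix (Fin n₁) (Fin r) ℝ) (σ : Fin r → ℝ) (V : Matrix (Fin n₂) (Fin r) ℝ)
      (μ₀ δ : ℝ),
      0 < r →
      Uᵀ * U = 1 → Vᵀ * V = 1 → (∀ k, 0 ≤ σ k) → M = U * Matrix.diagonal σ * Vᵀ →
      M.rank = r →
      coherence (columnSpan U) ≤ μ₀ →
      0 < δ →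
      36 * (r : ℝ) ^ (3 / 2 : ℝ) * μ₀ * Real.log (2 * r / δ) ≤ (m : ℝ) →
      -- exact recovery with the claimed probability
      1 - 4 * r * δ + δ ≤
          (uniformOn (Set.univ : Set (Fin m → Fin n₁))).real
            {ω | (Prog.sequentialCompletion n₁ n₂ m ℝ).eval M ω = M} ∧
      -- the expected number of observations with `m` draws
      ∫ ω, ((Prog.sequentialCompletion n₁ n₂ m ℝ).observations M ω : ℝ)
          ∂(uniformOn (Set.univ : Set (Fin m → Fin n₁))) ≤ (n₂ : ℝ) * m + r * n₁ ∧
      -- in particular, at the smallest admissible number of draws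
      ((m : ℝ) = 36 * (r : ℝ) ^ (3 / 2 : ℝ) * μ₀ * Real.log (2 * r / δ) →
        ∫ ω, ((Prog.sequentialCompletion n₁ n₂ m ℝ).observations M ω : ℝ)
            ∂(uniformOn (Set.univ : Set (Fin m → Fin n₁))) ≤
          36 * n₂ * (r : ℝ) ^ (3 / 2 : ℝ) * μ₀ * Real.log (2 * r / δ) + r * n₁) ∧
      -- the running time
      ∀ ω : Fin m → Fin n₁,
        ((Prog.sequentialCompletion n₁ n₂ m ℝ).steps M ω : ℝ) ≤
          C * ((n₁ : ℝ) * n₂ * r + (r : ℝ) ^ 3 * m) := by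
  -- The step count is at most `53 n₁n₂r + 18 r³m`, so `80` leaves room.
  refine ⟨80, ?_⟩
  intro n₁ n₂ r m M U σ V μ₀ δ hr hU hV _ hM _ hcoh hδ hm
  have hfin := finrank_columnSpan hU
  have hrn : r ≤ n₁ := by
    have := Submodule.finrank_le (columnSpan U)
    rwa [hfin, finrank_euclideanSpace_fin] at this
  -- This gives `n₂ > 0`, so that the term `2 n₁` from sampling is absorbed by `n₁ n₂ r`.
  have hrn₂ : r ≤ n₂ := by
    have := Submodule.finrank_le (columnSpan V)
    rwa [finrank_columnSpan hV, finrank_euclideanSpace_fin] at this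
  have hn : 0 < n₁ := hr.trans_le hrn
  have : Nonempty (Fin n₁) := ⟨⟨0, hn⟩⟩
  let W : Submodule ℝ (Fin n₁ → ℝ) :=
    (columnSpan U).map (WithLp.linearEquiv 2 ℝ (Fin n₁ → ℝ)).toLinearMap
  have hW : Module.finrank ℝ W ≤ r := by
    rw [← hfin]
    exact Submodule.finrank_map_le _ _
  have hMW : ∀ j, (fun i => M i j) ∈ W := fun j =>
    ⟨_, toLp_mulVec_mem_columnSpan U fun k => (Matrix.diagonal σ * Vᵀ) k j, by
      ext i
      rw [hM, Matrix.mul_assoc]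
      rfl⟩
  have hspec := fun ω : Fin m → Fin n₁ => Prog.sequentialCompletion_spec M ω hMW hW hr hn
  have hprob : IsProbabilityMeasure (uniformOn (Set.univ : Set (Fin m → Fin n₁))) :=
    isProbabilityMeasure_uniformOn Set.finite_univ Set.univ_nonempty
  have hobs : ∫ ω, ((Prog.sequentialCompletion n₁ n₂ m ℝ).observations M ω : ℝ)
      ∂(uniformOn (Set.univ : Set (Fin m → Fin n₁))) ≤ (n₂ : ℝ) * m + r * n₁ := by
    calc _ ≤ ∫ _ω, ((n₂ : ℝ) * m + r * n₁)
          ∂(uniformOn (Set.univ : Set (Fin m → Fin n₁))) :=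
          integral_mono Integrable.of_finite (integrable_const _) fun ω => by
            dsimp only
            exact_mod_cast (hspec ω).2.2
      _ = _ := by simp
  refine ⟨?_, hobs, fun hmeq => ?_, fun ω => ?_⟩
  · have hr1 : (1 : ℝ) ≤ r := by exact_mod_cast hr
    by_cases hδ1 : δ < 1
    · obtain ⟨hμ, hbad⟩ := card_vanishingOn_ne_bot_le (by rwa [hfin]) hcoh m
      rw [hfin] at hbad
      have hle := mul_exp_neg_le hr hμ hδ hδ1 hm
      have hsub : {ω : Fin m → Fin n₁ | vanishingOn (columnSpan U) ω ≠ ⊥}ᶜ ⊆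
          {ω | (Prog.sequentialCompletion n₁ n₂ m ℝ).eval M ω = M} := by
        intro ω hω
        have hω' : vanishingOn (columnSpan U) ω = ⊥ := by simpa using hω
        refine (hspec ω).1 ?_
        rintro _ ⟨x, hx, rfl⟩ h0
        have : x ∈ vanishingOn (columnSpan U) ω := ⟨hx, h0⟩
        rw [hω', Submodule.mem_bot] at this
        simp [this]
      refine le_trans ?_ (measureReal_mono hsub)
      rw [probReal_compl_eq_one_sub (Set.toFinite _).measurableSet, measureReal_uniformOn_univ]
      have hdiv : ((Set.ncard {ω : Fin m → Fin n₁ | vanishingOn (columnSpan U) ω ≠ ⊥} : ℕ) : ℝ) /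
          Fintype.card (Fin m → Fin n₁) ≤ r * Real.exp (-(m / (r * μ₀))) := by
        rw [div_le_iff₀ (by exact_mod_cast Fintype.card_pos)]
        simp only [Fintype.card_fun, Fintype.card_fin, Nat.cast_pow]
        linarith
      linarith
    -- For `δ ≥ 1` the claimed probability is negative.
    · refine le_trans ?_ measureReal_nonneg
      nlinarith
  · refine hobs.trans (le_of_eq ?_)
    rw [hmeq]
    ring
  · have h1 := (hspec ω).2.1
    have hn₂ : 0 < n₂ := hr.trans_le hrn₂
    have e1 : n₁ * 1 ≤ n₁ * (n₂ * r) := Nat.mul_le_mul le_rfl (Nat.mul_pos hn₂ hr)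
    have e2 : n₂ * 1 ≤ n₂ * (n₁ * r) := Nat.mul_le_mul le_rfl (Nat.mul_pos hn hr)
    have e3 : m * 1 ≤ m * r ^ 3 := Nat.mul_le_mul le_rfl (Nat.pow_pos hr)
    have : (Prog.sequentialCompletion n₁ n₂ m ℝ).steps M ω ≤
        80 * (n₁ * n₂ * r + r ^ 3 * m) := by nlinarith
    exact_mod_cast this
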